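/- Let $F,\Phi\in\mathbb{Z}[X,Y]$ with $d_X:=\deg_X(F)$, $d_Y:=\deg_Y(F)>0$, $\delta_X:=\deg_X(\Phi)$ and $\delta_Y:=\deg_Y(\Phi)>0$, and assume that $d_X$ and $\delta_X$ are not both zero. Let $\varphi$ be a real function on an open set $\mathrm{Dom}(\varphi)\subseteq\mathbb{R}$ satisfying $\varphi'(x)=\Phi(x,\varphi(x))$ for all $x\in\mathrm{Dom}(\varphi)$, and let $f(x)=F(x,\varphi(x))$. Then, for every (bounded or unbounded) open interval $I\subseteq\mathrm{Dom}(\varphi)$ on which $f$ is not identically zero, the number of (distinct) zeros of $f$ in $I$ is finite and at most $$(d_Y+1)\,(2d_Y^2-d_Y)\,\bigl((\delta_Y+3)\,d_X+\delta_X\bigr).$$ -/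

import Mathlib

open Polynomial
open scoped Polynomial.Bivariate

/-- The degree in `Y` of `F ∈ ℤ[X][Y]`; the outer variable of `ℤ[X][Y]` is `Y`. -/
noncomputable def degY (F : ℤ[X][Y]) : ℕ := F.natDegree

/-- The degree in `X` of `F ∈ ℤ[X][Y]`: the largest degree of a coefficient of `F`, seen as a
polynomial in `Y` with coefficients in `ℤ[X]`. -/
noncomputable def degX (F : ℤ[X][Y]) : ℕ := F.support.sup fun i => (F.coeff i).natDegree

/-- `SolvesOn Φ φ U`: the function `φ` is defined on the open set `U` and satisfies
`φ'(x) = Φ(x, φ(x))` there. (Only the values of `φ` on `U` matter; it is then automatically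
analytic on `U`.) -/
def SolvesOn (Φ : ℤ[X][Y]) (φ : ℝ → ℝ) (U : Set ℝ) : Prop :=
  IsOpen U ∧ ∀ x ∈ U, HasDerivAt φ (aevalAeval x (φ x) Φ) x

/-! Let D = ∂/∂X + Φ ∂/∂Y (`totalDeriv`), so that G(x, φ(x)) has derivative (DG)(x, φ(x)). Split F
into primes of ℤ[X,Y] and count the zeros that each factor contributes.

If a prime F divides DF, then f solves a homogeneous linear equation f' = hf, so it has no zero
unless it vanishes identically. Otherwise, if deg_Y F > 0, the resultants of F with ∂F/∂Y and with
DF are nonzero polynomials in X. On an interval avoiding their zeros, the real roots of F(x, ·) form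
disjoint differentiable branches, each of which solutions can cross in one direction only. The
integer `crossingIndex` grows by 2 across each meeting of φ with a branch, yet has absolute value
below deg_Y F at the meeting; hence there are at most deg_Y F meetings (`card_zeros_le_natDegree`).

Summing over the intervals gives a bound that is superadditive in the two degrees of F, so it passes
to products (`encard_zeros_le`). It is below the stated bound except when d_Y = 1 and d_X = 0; there
a form of Rolle's theorem gives δ_X + 1 ≤ 2δ_X (`encard_zeros_le_of_linear`). -/

/-! ### Degrees and derivations of bivariate polynomials. -/

theorem degX_le_iff {F : ℤ[X][Y]} {n : ℕ} : degX F ≤ n ↔ ∀ i, (F.coeff i).natDegree ≤ n := by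
  rw [degX, Finset.sup_le_iff]
  refine ⟨fun h i => ?_, fun h i _ => h i⟩
  by_cases hi : i ∈ F.support
  · exact h i hi
  · simp [notMem_support_iff.mp hi]

theorem natDegree_coeff_le_degX (F : ℤ[X][Y]) (i : ℕ) : (F.coeff i).natDegree ≤ degX F :=
  degX_le_iff.mp le_rfl i

theorem coeff_coeff_swap {R : Type*} [CommSemiring R] (F : R[X][Y]) (i j : ℕ) :
    ((Bivariate.swap F).coeff i).coeff j = (F.coeff j).coeff i := by
  induction F using Polynomial.induction_on' with
  | add p q hp hq => simp only [map_add, coeff_add, hp, hq]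
  | monomial n a =>
    induction a using Polynomial.induction_on' with
    | add p q hp hq => simp only [map_add, coeff_add, hp, hq]
    | monomial m r =>
      rw [Bivariate.swap_monomial_monomial]
      simp only [coeff_monomial]
      split_ifs <;> simp_all [coeff_monomial]

/-- Exchanging the variables makes additivity of the X-degree on products a case of `natDegree_mul`.
-/
theorem degX_eq_natDegree_swap (F : ℤ[X][Y]) : degX F = (Bivariate.swap F).natDegree := by
  apply le_antisymm
  · refine degX_le_iff.mpr fun i => natDegree_le_iff_coeff_eq_zero.mpr fun j hj => ?_
    rw [← coeff_coeff_swap, coeff_eq_zero_of_natDegree_lt hj, coeff_zero]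
  · refine natDegree_le_iff_coeff_eq_zero.mpr fun j hj => ?_
    ext i
    rw [coeff_coeff_swap, coeff_zero]
    exact coeff_eq_zero_of_natDegree_lt ((natDegree_coeff_le_degX F i).trans_lt hj)

theorem degX_mul {F G : ℤ[X][Y]} (hF : F ≠ 0) (hG : G ≠ 0) :
    degX (F * G) = degX F + degX G := by
  simp only [degX_eq_natDegree_swap, map_mul]
  exact natDegree_mul (by simpa using hF) (by simpa using hG)

theorem degX_add_le {F G : ℤ[X][Y]} {n : ℕ} (hF : degX F ≤ n) (hG : degX G ≤ n) :
    degX (F + G) ≤ n :=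
  degX_le_iff.mpr fun i => by
    rw [coeff_add]
    exact natDegree_add_le_of_degree_le (degX_le_iff.mp hF i) (degX_le_iff.mp hG i)

theorem degX_mul_le (F G : ℤ[X][Y]) : degX (F * G) ≤ degX F + degX G := by
  simp only [degX_eq_natDegree_swap, map_mul]
  exact natDegree_mul_le

/-- The partial derivative with respect to `X`. -/
noncomputable def derivX (F : ℤ[X][Y]) : ℤ[X][Y] :=
  Bivariate.swap (derivative (Bivariate.swap F))

theorem coeff_derivX (F : ℤ[X][Y]) (i : ℕ) : (derivX F).coeff i = derivative (F.coeff i) := by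
  ext j
  rw [derivX, coeff_coeff_swap, coeff_derivative, coeff_derivative, ← coeff_coeff_swap]
  have : ((j : ℤ[X]) + 1) = C ((j : ℤ) + 1) := by simp
  rw [this, coeff_mul_C]

theorem degX_derivX_le (F : ℤ[X][Y]) : degX (derivX F) ≤ degX F :=
  degX_le_iff.mpr fun i => by
    rw [coeff_derivX]
    exact (natDegree_derivative_le _).trans
      ((Nat.sub_le _ _).trans (natDegree_coeff_le_degX F i))

theorem natDegree_derivX_le (F : ℤ[X][Y]) : (derivX F).natDegree ≤ F.natDegree :=
  natDegree_le_iff_coeff_eq_zero.mpr fun i hi => by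
    rw [coeff_derivX, coeff_eq_zero_of_natDegree_lt hi, derivative_zero]

theorem degX_derivative_le (F : ℤ[X][Y]) : degX (derivative F) ≤ degX F :=
  degX_le_iff.mpr fun i => by
    rw [coeff_derivative, show ((i : ℤ[X]) + 1) = C ((i : ℤ) + 1) by simp]
    exact (natDegree_mul_C_le _ _).trans (natDegree_coeff_le_degX F _)

/-- The derivative of `F` along the vector field `∂/∂X + Φ ∂/∂Y`. -/
noncomputable def totalDeriv (Φ F : ℤ[X][Y]) : ℤ[X][Y] := derivX F + Φ * derivative F

theorem degX_totalDeriv_le (Φ F : ℤ[X][Y]) : degX (totalDeriv Φ F) ≤ degX F + degX Φ := by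
  refine degX_add_le ((degX_derivX_le F).trans (Nat.le_add_right _ _)) ?_
  have h1 := degX_mul_le Φ (derivative F)
  have h2 := degX_derivative_le F
  omega

theorem natDegree_totalDeriv_le (Φ F : ℤ[X][Y]) (hΦ : 0 < Φ.natDegree) (hF : 0 < F.natDegree) :
    (totalDeriv Φ F).natDegree ≤ F.natDegree - 1 + Φ.natDegree := by
  refine natDegree_add_le_of_degree_le ((natDegree_derivX_le F).trans (by omega)) ?_
  have h1 := natDegree_mul_le (p := Φ) (q := derivative F)
  have h2 := natDegree_derivative_le F
  omega

/-! ### Resultants with respect to Y. -/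

theorem natDegree_resultant_le (F G : ℤ[X][Y]) :
    (resultant F G).natDegree ≤ G.natDegree * degX F + F.natDegree * degX G := by
  rw [resultant, Matrix.det_apply]
  refine natDegree_sum_le_of_forall_le _ _ fun σ _ => ?_
  refine (natDegree_smul_le _ _).trans ((natDegree_prod_le _ _).trans ?_)
  rw [Fin.sum_univ_add]
  have h1 : ∀ i j, ((sylvester F G F.natDegree G.natDegree) i
      (Fin.castAdd G.natDegree j)).natDegree ≤ degX G := fun i j => by
    simp only [sylvester, Matrix.of_apply, Fin.addCases_left]
    split_ifs
    · exact natDegree_coeff_le_degX _ _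
    · simp
  have h2 : ∀ i j, ((sylvester F G F.natDegree G.natDegree) i
      (Fin.natAdd F.natDegree j)).natDegree ≤ degX F := fun i j => by
    simp only [sylvester, Matrix.of_apply, Fin.addCases_right]
    split_ifs
    · exact natDegree_coeff_le_degX _ _
    · simp
  have h3 := Finset.sum_le_sum (s := Finset.univ) fun j _ => h1 (σ (Fin.castAdd G.natDegree j)) j
  have h4 := Finset.sum_le_sum (s := Finset.univ) fun j _ => h2 (σ (Fin.natAdd F.natDegree j)) j
  simp only [Finset.sum_const, Finset.card_univ, Fintype.card_fin, smul_eq_mul] at h3 h4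
  omega

/-- A kernel vector of the Sylvester matrix is a relation Fq + Gp = 0 with deg p < deg F. As F is
prime and does not divide G, it divides p, so p = 0 and then q = 0. -/
theorem resultant_ne_zero_of_prime {R : Type*} [CommRing R] [IsDomain R] {F G : R[X]}
    (hF : Prime F) (hG : ¬ F ∣ G) : resultant F G ≠ 0 := by
  intro h
  obtain ⟨v, hv0, hv⟩ := Matrix.exists_mulVec_eq_zero_iff.mpr h
  set b := ((degreeLT.basis R F.natDegree).prod (degreeLT.basis R G.natDegree)).reindex
    finSumFinEquiv
  have hv' : sylvesterMap F G le_rfl le_rfl (b.equivFun.symm v) = 0 := by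
    rw [← toMatrix_sylvesterMap' F G le_rfl le_rfl] at hv
    have := LinearMap.toMatrix_mulVec_repr b (degreeLT.basis R _)
      (sylvesterMap F G le_rfl le_rfl) (b.equivFun.symm v)
    have h2 : ⇑(b.repr (b.equivFun.symm v)) = v := by
      rw [← Module.Basis.equivFun_apply, LinearEquiv.apply_symm_apply]
    rw [h2, hv] at this
    apply (degreeLT.basis R _).repr.injective
    ext i
    rw [← this]; simp
  obtain ⟨⟨p, q⟩, hpq⟩ : ∃ pq, pq = b.equivFun.symm v := ⟨_, rfl⟩
  rw [← hpq] at hv'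
  have hne : (p, q) ≠ 0 := by
    rw [hpq]; exact (LinearEquiv.map_ne_zero_iff _).mpr hv0
  have hv2 : F * (q : R[X]) + G * (p : R[X]) = 0 := by
    simpa using congrArg Subtype.val hv'
  have hdvd : F ∣ (p : R[X]) := by
    refine (hF.dvd_or_dvd (a := G) (b := p) ⟨-q, ?_⟩).resolve_left hG
    linear_combination hv2
  have hp : (p : R[X]) = 0 := by
    refine eq_zero_of_dvd_of_degree_lt hdvd ?_
    rw [degree_eq_natDegree hF.ne_zero]
    exact mem_degreeLT.mp p.2
  have hq : (q : R[X]) = 0 := by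
    rw [hp, mul_zero, add_zero] at hv2
    exact (mul_eq_zero.mp hv2).resolve_left hF.ne_zero
  exact hne (Prod.ext (Subtype.ext hp) (Subtype.ext hq))

theorem aeval_resultant_eq_zero {F G : ℤ[X][Y]} (hF : 0 < F.natDegree) {x y : ℝ}
    (h1 : aevalAeval x y F = 0) (h2 : aevalAeval x y G = 0) : aeval x (resultant F G) = 0 := by
  obtain ⟨p, q, -, -, h⟩ := exists_mul_add_mul_eq_C_resultant F G le_rfl le_rfl (Or.inl hF.ne')
  have := congrArg (aevalAeval x y) h
  rwa [map_add, map_mul, map_mul, h1, h2, zero_mul, zero_mul, add_zero, aevalAeval_C,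
    eq_comm] at this

/-- This resultant is, up to sign, the leading coefficient times the discriminant; so away from its
zeros the degree of F(x, ·) does not drop. -/
theorem aeval_resultant_derivative_eq_zero {F : ℤ[X][Y]} (hF : 0 < F.natDegree) {x : ℝ}
    (h : aeval x F.leadingCoeff = 0) : aeval x (resultant F (derivative F)) = 0 := by
  have := resultant_deriv (natDegree_pos_iff_degree_pos.mp hF)
  rw [natDegree_derivative, this, map_mul, map_mul, h, mul_zero, zero_mul]

/-! ### Evaluation at real points and the chain rule. -/

/-- The polynomial in `Y` obtained from `F` by the substitution `X = x`. -/
noncomputable def fiber (x : ℝ) (F : ℤ[X][Y]) : ℝ[X] := F.map (aeval x : ℤ[X] →ₐ[ℤ] ℝ).toRingHom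

theorem eval_fiber (x y : ℝ) (F : ℤ[X][Y]) : (fiber x F).eval y = aevalAeval x y F := by
  induction F using Polynomial.induction_on' with
  | add p q hp hq => rw [map_add, ← hp, ← hq]; simp [fiber]
  | monomial n a =>
    rw [← C_mul_X_pow_eq_monomial, map_mul, map_pow, aevalAeval_C, aevalAeval_Y]
    simp only [fiber, Polynomial.map_mul, Polynomial.map_pow, map_C, map_X, eval_mul, eval_pow,
      eval_C, eval_X]
    rfl

theorem coeff_fiber (x : ℝ) (F : ℤ[X][Y]) (i : ℕ) : (fiber x F).coeff i = aeval x (F.coeff i) := by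
  simp [fiber]

theorem derivative_fiber (x : ℝ) (F : ℤ[X][Y]) :
    derivative (fiber x F) = fiber x (derivative F) := by
  simp [fiber, derivative_map]

theorem continuous_aevalAeval (F : ℤ[X][Y]) :
    Continuous fun p : ℝ × ℝ => aevalAeval p.1 p.2 F := by
  have h : ∀ x y : ℝ, aevalAeval x y F =
      ∑ i ∈ Finset.range (F.natDegree + 1), aeval x (F.coeff i) * y ^ i := fun x y => by
    rw [← eval_fiber, eval_eq_sum_range' (p := fiber x F) (Nat.lt_succ_of_le natDegree_map_le)]
    simp only [coeff_fiber]
  simp only [h]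
  refine continuous_finsetSum _ fun i _ => ?_
  exact ((Polynomial.continuous_aeval _).comp continuous_fst).mul (continuous_snd.pow i)

theorem hasDerivAt_aevalAeval_right (F : ℤ[X][Y]) (x y : ℝ) :
    HasDerivAt (fun y => aevalAeval x y F) (aevalAeval x y (derivative F)) y := by
  have := (fiber x F).hasDerivAt y
  rw [derivative_fiber] at this
  simpa only [eval_fiber] using this

theorem hasDerivAt_aevalAeval_left (F : ℤ[X][Y]) (x y : ℝ) :
    HasDerivAt (fun x => aevalAeval x y F) (aevalAeval x y (derivX F)) x := by
  have := hasDerivAt_aevalAeval_right (Bivariate.swap F) y x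
  simpa only [derivX, Bivariate.aevalAeval_swap] using this

/-- The partial derivatives are continuous. Strictness is what the implicit function theorem needs.
-/
theorem hasStrictFDerivAt_aevalAeval (F : ℤ[X][Y]) (u : ℝ × ℝ) :
    HasStrictFDerivAt (fun p : ℝ × ℝ => aevalAeval p.1 p.2 F)
      ((ContinuousLinearMap.toSpanSingleton ℝ (aevalAeval u.1 u.2 (derivX F))).coprod
        (ContinuousLinearMap.toSpanSingleton ℝ (aevalAeval u.1 u.2 (derivative F)))) u := by
  refine hasStrictFDerivAt_uncurry_coprod (f := fun x y => aevalAeval x y F)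
    (f₁ := fun x y => ContinuousLinearMap.toSpanSingleton ℝ (aevalAeval x y (derivX F)))
    (f₂ := fun x y => ContinuousLinearMap.toSpanSingleton ℝ (aevalAeval x y (derivative F)))
    (Filter.Eventually.of_forall fun v => (hasDerivAt_aevalAeval_left F v.1 v.2).hasFDerivAt)
    (Filter.Eventually.of_forall fun v => (hasDerivAt_aevalAeval_right F v.1 v.2).hasFDerivAt)
    ?_ ?_
  · exact ((ContinuousLinearMap.toSpanSingletonCLE (𝕜 := ℝ) (E := ℝ)).continuous.comp
      (continuous_aevalAeval (derivX F))).continuousAt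
  · exact ((ContinuousLinearMap.toSpanSingletonCLE (𝕜 := ℝ) (E := ℝ)).continuous.comp
      (continuous_aevalAeval (derivative F))).continuousAt

theorem hasDerivAt_aevalAeval_comp (F : ℤ[X][Y]) {r : ℝ → ℝ} {r' x : ℝ} (hr : HasDerivAt r r' x) :
    HasDerivAt (fun x => aevalAeval x (r x) F)
      (aevalAeval x (r x) (derivX F) + r' * aevalAeval x (r x) (derivative F)) x := by
  have h := (hasStrictFDerivAt_aevalAeval F (x, r x)).hasFDerivAt.comp_hasDerivAt
    (f := fun x => (x, r x)) x ((hasDerivAt_id x).prodMk hr)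
  exact h.congr_deriv (by simp [ContinuousLinearMap.toSpanSingleton_apply])

theorem SolvesOn.hasDerivAt_aevalAeval {Φ : ℤ[X][Y]} {φ : ℝ → ℝ} {U : Set ℝ}
    (h : SolvesOn Φ φ U) (F : ℤ[X][Y]) {x : ℝ} (hx : x ∈ U) :
    HasDerivAt (fun x => aevalAeval x (φ x) F) (aevalAeval x (φ x) (totalDeriv Φ F)) x :=
  (hasDerivAt_aevalAeval_comp F (h.2 x hx)).congr_deriv (by simp only [totalDeriv, map_add, map_mul])

theorem SolvesOn.continuousOn_aevalAeval {Φ : ℤ[X][Y]} {φ : ℝ → ℝ} {U : Set ℝ}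
    (h : SolvesOn Φ φ U) (F : ℤ[X][Y]) : ContinuousOn (fun x => aevalAeval x (φ x) F) U :=
  fun _ hx => (h.hasDerivAt_aevalAeval F hx).continuousAt.continuousWithinAt

/-! ### Linear differential equations of first order. -/

/-- The integrating factor of the linear equation `g' = h g + p`. -/
theorem exists_integrating_factor {g h p : ℝ → ℝ} {a b : ℝ}
    (hg : ∀ x ∈ Set.Icc a b, HasDerivAt g (h x * g x + p x) x)
    (hh : ContinuousOn h (Set.Icc a b)) (hab : a < b) :
    ∃ μ : ℝ → ℝ, (∀ x, 0 < μ x) ∧ ContinuousOn (fun x => g x * μ x) (Set.Icc a b) ∧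
      ∀ x ∈ Set.Ioo a b, HasDerivAt (fun x => g x * μ x) (p x * μ x) x := by
  -- The factor is exp(-A). Since `h` is only continuous within [a, b], `A` is differentiated only
  -- in the interior.
  set A : ℝ → ℝ := fun x => ∫ t in a..x, h t
  have hA : ∀ x ∈ Set.Ioo a b, HasDerivAt A (h x) x := fun x hx =>
    intervalIntegral.integral_hasDerivAt_right
      ((hh.mono (Set.Icc_subset_Icc_right hx.2.le)).intervalIntegrable_of_Icc hx.1.le)
      (hh.stronglyMeasurableAtFilter_nhdsWithin measurableSet_Icc x |>.filter_mono
        (le_of_eq (nhdsWithin_eq_nhds.mpr (Icc_mem_nhds hx.1 hx.2)).symm))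
      (hh.continuousAt (Icc_mem_nhds hx.1 hx.2))
  have hAc : ContinuousOn A (Set.Icc a b) := by
    have := intervalIntegral.continuousOn_primitive_interval (μ := MeasureTheory.volume)
      (f := h) (a := a) (b := b) (by rw [Set.uIcc_of_le hab.le]; exact hh.integrableOn_Icc)
    rwa [Set.uIcc_of_le hab.le] at this
  have hgc : ContinuousOn g (Set.Icc a b) :=
    fun x hx => (hg x hx).continuousAt.continuousWithinAt
  refine ⟨fun x => Real.exp (-A x), fun x => Real.exp_pos _, hgc.mul hAc.neg.rexp,
    fun x hx => ((hg x (Set.Ioo_subset_Icc_self hx)).mul ((hA x hx).neg.exp)).congr_deriv ?_⟩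
  simp only [Pi.neg_apply]
  ring

/-- Rolle's theorem for solutions of the linear equation `g' = h g + p`. -/
theorem exists_eq_zero_of_linear_ode {g h p : ℝ → ℝ} {a b : ℝ} (hab : a < b)
    (hg : ∀ x ∈ Set.Icc a b, HasDerivAt g (h x * g x + p x) x)
    (hh : ContinuousOn h (Set.Icc a b)) (ha : g a = 0) (hb : g b = 0) :
    ∃ c ∈ Set.Ioo a b, p c = 0 := by
  obtain ⟨μ, hμ, hc, hd⟩ := exists_integrating_factor hg hh hab
  obtain ⟨c, hc, hc0⟩ := exists_hasDerivAt_eq_zero hab hc (by simp [ha, hb]) hd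
  exact ⟨c, hc, (mul_eq_zero.mp hc0).resolve_right (hμ c).ne'⟩

/-- A solution of a homogeneous linear equation on an interval that vanishes somewhere vanishes
everywhere. -/
theorem eq_zero_of_linear_ode {g h : ℝ → ℝ} {I : Set ℝ} (hI : I.OrdConnected)
    (hg : ∀ x ∈ I, HasDerivAt g (h x * g x) x) (hh : ContinuousOn h I) {a b : ℝ} (ha : a ∈ I)
    (hb : b ∈ I) (h0 : g a = 0) : g b = 0 := by
  have key : ∀ a ∈ I, ∀ b ∈ I, a < b → (g a = 0 ↔ g b = 0) := fun a ha b hb hab => by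
    obtain ⟨μ, hμ, hc, hd⟩ := exists_integrating_factor (p := 0)
      (fun x hx => (hg x (hI.out ha hb hx)).congr_deriv (by simp)) (hh.mono (hI.out ha hb)) hab
    -- Here gμ has zero derivative, so the mean value theorem gives g(a)μ(a) = g(b)μ(b).
    obtain ⟨c, -, hc'⟩ := exists_hasDerivAt_eq_slope _ _ hab hc hd
    rw [Pi.zero_apply, zero_mul, eq_comm, div_eq_zero_iff, or_iff_left (sub_pos.mpr hab).ne',
      sub_eq_zero] at hc'
    constructor <;> intro h <;> rw [h, zero_mul] at hc'
    · exact (mul_eq_zero.mp hc').resolve_right (hμ b).ne'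
    · exact (mul_eq_zero.mp hc'.symm).resolve_right (hμ a).ne'
  rcases lt_trichotomy a b with h | h | h
  · exact (key a ha b hb h).mp h0
  · exact h ▸ h0
  · exact (key b hb a ha h).mpr h0

/-! ### Integer-valued functions with prescribed jumps. -/

open Filter Topology in
-- Real induction on the x such that W ≥ W(a) on [a, x]: the left condition makes this set closed in
-- [a, b], the right one lets it be extended past each of its points.
theorem le_of_locally_monotone {W : ℝ → ℤ} {a b : ℝ} (hab : a ≤ b)
    (hl : ∀ x₀ ∈ Set.Icc a b, ∀ᶠ x in 𝓝 x₀, x < x₀ → W x ≤ W x₀)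
    (hr : ∀ x₀ ∈ Set.Icc a b, ∀ᶠ x in 𝓝 x₀, x₀ < x → W x₀ ≤ W x) : W a ≤ W b := by
  let s : Set ℝ := {x | ∀ t ∈ Set.Icc a x, W a ≤ W t}
  have hsub : Set.Icc a b ⊆ s := by
    refine IsClosed.Icc_subset_of_forall_mem_nhdsWithin ?_ ?_ ?_
    · refine isClosed_of_closure_subset fun x₀ hx₀ => ?_
      have hx₀' : x₀ ∈ Set.Icc a b :=
        closure_minimal Set.inter_subset_right isClosed_Icc hx₀
      have hlt : ∀ t ∈ Set.Ico a x₀, W a ≤ W t := fun t ht => by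
        obtain ⟨x, hx, hxs⟩ := mem_closure_iff_nhds.mp hx₀ _ (Ioi_mem_nhds ht.2)
        exact hxs.1 t ⟨ht.1, le_of_lt hx⟩
      refine ⟨fun t ht => ?_, hx₀'⟩
      rcases ht.2.lt_or_eq with h | rfl
      · exact hlt t ⟨ht.1, h⟩
      rcases ht.1.lt_or_eq with h | rfl
      · obtain ⟨x, hx, hx1⟩ := (((hl t hx₀').filter_mono nhdsWithin_le_nhds).and
          (Ioo_mem_nhdsLT h)).exists
        exact (hlt x ⟨hx1.1.le, hx1.2⟩).trans (hx hx1.2)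
      · exact le_rfl
    · intro t ht
      rw [le_antisymm ht.2 ht.1]
    · intro x hx
      obtain ⟨ε, hε, h⟩ := Metric.eventually_nhds_iff.mp (hr x (Set.Ico_subset_Icc_self hx.2))
      filter_upwards [Ioo_mem_nhdsGT (lt_add_of_pos_right x hε)] with y hy t ht
      rcases le_or_gt t x with htx | htx
      · exact hx.1 t ⟨ht.1, htx⟩
      · refine (hx.1 x ⟨hx.2.1, le_rfl⟩).trans (h ?_ htx)
        rw [Real.dist_eq, abs_lt]
        constructor <;> linarith [ht.2, hy.2]
  exact hsub ⟨hab, le_rfl⟩ b ⟨hab, le_rfl⟩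

open Filter Topology in
/-- If an integer valued function is locally constant outside `Z` and has a jump of `1` on either
side of each point of `Z`, and if it is bounded by `d - 1` on `Z`, then `Z` has at most `d`
points. -/
theorem card_le_of_jumps {W : ℝ → ℤ} {J Z : Set ℝ} [DecidablePred (· ∈ Z)] (hJ : J.OrdConnected)
    (h : ∀ x₀ ∈ J, ∀ᶠ x in 𝓝 x₀,
      W x = W x₀ + if x₀ ∈ Z then (SignType.sign (x - x₀) : ℤ) else 0)
    {d : ℕ} (hd : ∀ x ∈ Z, |W x| + 1 ≤ d) (T : Finset ℝ) (hT : ∀ x ∈ T, x ∈ J ∧ x ∈ Z) :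
    T.card ≤ d := by
  have hmono : ∀ a ∈ J, ∀ b ∈ J, a ≤ b → W a ≤ W b := fun a ha b hb hab => by
    refine le_of_locally_monotone hab (fun x hx => ?_) (fun x hx => ?_)
    all_goals
      filter_upwards [h x (hJ.out ha hb hx)] with y hy hyx
      rw [hy]
      split_ifs
    · rw [sign_neg (sub_neg.mpr hyx)]; simp
    · simp
    · rw [sign_pos (sub_pos.mpr hyx)]; simp
    · simp
  have hjump : ∀ a ∈ T, ∀ b ∈ T, a < b → W a + 2 ≤ W b := fun a ha b hb hab => by
    obtain ⟨x, hx, hxab⟩ := (((h a (hT a ha).1).filter_mono nhdsWithin_le_nhds).and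
      (Ioo_mem_nhdsGT hab)).exists
    obtain ⟨y, hy, hyxb⟩ := (((h b (hT b hb).1).filter_mono nhdsWithin_le_nhds).and
      (Ioo_mem_nhdsLT hxab.2)).exists
    rw [if_pos (hT a ha).2, sign_pos (sub_pos.mpr hxab.1)] at hx
    rw [if_pos (hT b hb).2, sign_neg (sub_neg.mpr hyxb.2)] at hy
    have := hmono x (hJ.out (hT a ha).1 (hT b hb).1 ⟨hxab.1.le, hxab.2.le⟩) y
      (hJ.out (hT a ha).1 (hT b hb).1 ⟨(hxab.1.trans hyxb.1).le, hyxb.2.le⟩) hyxb.1.le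
    simp at hx hy
    omega
  -- On `T` the values of W lie in [-(d-1), d-1] and distinct points have values at least 2 apart,
  -- so halving the shifted value is injective into d slots.
  have hcard := Finset.card_le_card_of_injOn (s := T) (t := Finset.range d)
    (fun x => ((W x + (d - 1)) / 2).toNat) (fun x hx => by
      have h1 := hd x (hT x hx).2
      have h2 := abs_le.mp (show |W x| ≤ d - 1 by omega)
      simp only [Finset.coe_range, Set.mem_Iio]
      omega) (fun x hx y hy hxy => by
      have h1 := abs_le.mp (show |W x| ≤ d - 1 by linarith [hd x (hT x hx).2])
      have h2 := abs_le.mp (show |W y| ≤ d - 1 by linarith [hd y (hT y hy).2])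
      simp only at hxy
      rcases lt_trichotomy x y with h3 | h3 | h3
      · have := hjump x hx y hy h3
        omega
      · exact h3
      · have := hjump y hy x hx h3
        omega)
  simpa using hcard

/-! ### Branches of real roots. -/

open Filter Topology in
theorem exists_local_root (F : ℤ[X][Y]) {x₀ y₀ : ℝ} (h : aevalAeval x₀ y₀ F = 0)
    (h' : aevalAeval x₀ y₀ (derivative F) ≠ 0) :
    ∃ r : ℝ → ℝ, r x₀ = y₀ ∧
      HasDerivAt r (-aevalAeval x₀ y₀ (derivX F) / aevalAeval x₀ y₀ (derivative F)) x₀ ∧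
      ∀ᶠ v in 𝓝 (x₀, y₀), aevalAeval v.1 v.2 F = 0 ↔ r v.1 = v.2 := by
  have hs := hasStrictFDerivAt_aevalAeval F (x₀, y₀)
  have hinv : (((ContinuousLinearMap.toSpanSingleton ℝ (aevalAeval x₀ y₀ (derivX F))).coprod
        (ContinuousLinearMap.toSpanSingleton ℝ (aevalAeval x₀ y₀ (derivative F)))) ∘L
        ContinuousLinearMap.inr ℝ ℝ ℝ).IsInvertible := by
    refine ⟨ContinuousLinearEquiv.unitsEquivAut ℝ (Units.mk0 _ h'), ?_⟩
    ext
    simp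
  set r := hs.implicitFunctionOfProdDomain hinv
  have hev := hs.eventually_apply_eq_iff_implicitFunctionOfProdDomain hinv
  simp only [h] at hev
  have hr : r x₀ = y₀ := hev.self_of_nhds.mp h
  obtain ⟨r', hr'⟩ : ∃ r', HasDerivAt r r' x₀ :=
    ⟨_, (hs.hasStrictFDerivAt_implicitFunctionOfProdDomain hinv).hasFDerivAt.hasDerivAt⟩
  refine ⟨r, hr, ?_, hev⟩
  have h1 := hasDerivAt_aevalAeval_comp F hr'
  have h2 : HasDerivAt (fun x => aevalAeval x (r x) F) 0 x₀ := by
    refine (hasDerivAt_const x₀ (0 : ℝ)).congr_of_eventuallyEq ?_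
    filter_upwards [hs.eventually_apply_implicitFunctionOfProdDomain hinv] with x hx
    rw [← h]; exact hx
  have h3 := h1.unique h2
  rw [hr] at h3
  refine hr'.congr_deriv ?_
  rw [eq_div_iff h']
  linarith

/-- The set of real zeros of `F(x, ·)`. -/
noncomputable def realRoots (x : ℝ) (F : ℤ[X][Y]) : Finset ℝ := (fiber x F).roots.toFinset

theorem fiber_ne_zero {x : ℝ} {F : ℤ[X][Y]} (h : aeval x F.leadingCoeff ≠ 0) : fiber x F ≠ 0 := by
  intro h0
  apply h
  rw [leadingCoeff, ← coeff_fiber, h0, coeff_zero]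

theorem mem_realRoots {x y : ℝ} {F : ℤ[X][Y]} (h : aeval x F.leadingCoeff ≠ 0) :
    y ∈ realRoots x F ↔ aevalAeval x y F = 0 := by
  rw [realRoots, Multiset.mem_toFinset, mem_roots (fiber_ne_zero h), IsRoot.def, eval_fiber]

theorem card_realRoots_le (x : ℝ) (F : ℤ[X][Y]) : (realRoots x F).card ≤ F.natDegree :=
  (Multiset.toFinset_card_le _).trans ((card_roots' _).trans natDegree_map_le)

open Filter Topology in
theorem exists_bound_realRoots (F : ℤ[X][Y]) {x₀ : ℝ} (h : aeval x₀ F.leadingCoeff ≠ 0) :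
    ∃ M : ℝ, ∀ᶠ x in 𝓝 x₀, ∀ y, aevalAeval x y F = 0 → |y| ≤ M := by
  -- Cauchy's root bound with the maximum of the coefficients replaced by their sum, which is
  -- visibly continuous in x.
  set B : ℝ → ℝ := fun x =>
    (∑ i ∈ Finset.range F.natDegree, |aeval x (F.coeff i)|) / |aeval x F.leadingCoeff| + 1
  have hc : ∀ p : ℤ[X], Continuous fun x : ℝ => |aeval x p| :=
    fun p => (Polynomial.continuous_aeval p).abs
  have hB : ContinuousAt B x₀ :=
    ((continuous_finsetSum _ fun i _ => hc _).continuousAt.div (hc _).continuousAt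
      (abs_ne_zero.mpr h)).add continuousAt_const
  refine ⟨B x₀ + 1, ?_⟩
  filter_upwards [hB.eventually (gt_mem_nhds (lt_add_one (B x₀))),
    (Polynomial.continuous_aeval F.leadingCoeff).continuousAt.eventually_ne h] with x hx hlc y hy
  refine le_trans ?_ hx.le
  have hdeg : (fiber x F).natDegree = F.natDegree := natDegree_map_of_leadingCoeff_ne_zero _ hlc
  have hroot : (fiber x F).IsRoot y := by rw [IsRoot.def, eval_fiber, hy]
  have hlt : |y| < cauchyBound (fiber x F) := by
    exact_mod_cast hroot.norm_lt_cauchyBound (fiber_ne_zero hlc)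
  refine hlt.le.trans ?_
  rw [cauchyBound, leadingCoeff, hdeg]
  push_cast
  simp only [coeff_fiber, Real.norm_eq_abs, B, leadingCoeff]
  gcongr
  have : (Finset.range F.natDegree).sup (fun i => ‖aeval x (F.coeff i)‖₊) ≤
      ∑ i ∈ Finset.range F.natDegree, ‖aeval x (F.coeff i)‖₊ :=
    Finset.sup_le fun i hi =>
      Finset.single_le_sum (f := fun i => ‖aeval x (F.coeff i)‖₊) (fun _ _ => zero_le) hi
  have := NNReal.coe_le_coe.mpr this
  simpa only [NNReal.coe_sum, coe_nnnorm, Real.norm_eq_abs] using this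

open Filter Topology in
/-- The real zeros of `F(x, ·)` depend differentiably on `x` as long as they are simple and the
degree does not drop. -/
theorem exists_local_roots (F : ℤ[X][Y]) {x₀ : ℝ} (h : aeval x₀ F.leadingCoeff ≠ 0)
    (hs : ∀ y, aevalAeval x₀ y F = 0 → aevalAeval x₀ y (derivative F) ≠ 0) :
    ∃ r : ℝ → ℝ → ℝ, (∀ y ∈ realRoots x₀ F, r y x₀ = y ∧
      HasDerivAt (r y) (-aevalAeval x₀ y (derivX F) / aevalAeval x₀ y (derivative F)) x₀) ∧
      ∀ᶠ x in 𝓝 x₀, realRoots x F = (realRoots x₀ F).image (fun y => r y x) ∧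
        Set.InjOn (fun y => r y x) (realRoots x₀ F) := by
  have hex : ∀ y, ∃ r : ℝ → ℝ, y ∈ realRoots x₀ F → r x₀ = y ∧
      HasDerivAt r (-aevalAeval x₀ y (derivX F) / aevalAeval x₀ y (derivative F)) x₀ ∧
      ∀ᶠ v in 𝓝 (x₀, y), aevalAeval v.1 v.2 F = 0 ↔ r v.1 = v.2 := fun y => by
    by_cases hy : y ∈ realRoots x₀ F
    · rw [mem_realRoots h] at hy
      obtain ⟨r, hr⟩ := exists_local_root F hy (hs y hy)
      exact ⟨r, fun _ => hr⟩
    · exact ⟨0, fun h => absurd h hy⟩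
  choose r hr using hex
  refine ⟨r, fun y hy => ⟨(hr y hy).1, (hr y hy).2.1⟩, ?_⟩
  obtain ⟨M, hM⟩ := exists_bound_realRoots F h
  -- Near each (x₀, y) the zero set is a single branch or empty; compactness of [-M, M] gives one
  -- neighbourhood of x₀ valid for all y, so no new root appears.
  have hK := (isCompact_Icc (a := -M) (b := M)).eventually_forall_of_forall_eventually
    (x₀ := x₀) (P := fun x y => aevalAeval x y F = 0 → ∃ y' ∈ realRoots x₀ F, r y' x = y)
    fun y _ => by
      by_cases hy : y ∈ realRoots x₀ F
      · filter_upwards [(hr y hy).2.2] with v hv h0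
        exact ⟨y, hy, hv.mp h0⟩
      · filter_upwards [(continuous_aevalAeval F).continuousAt.eventually_ne
          (x := (x₀, y)) (mt (mem_realRoots h).mpr hy)] with v hv h0
        exact absurd h0 hv
  have hroot : ∀ᶠ x in 𝓝 x₀, ∀ y ∈ realRoots x₀ F, aevalAeval x (r y x) F = 0 := by
    rw [Filter.eventually_all_finset]
    intro y hy
    have hc := (hr y hy).2.1.continuousAt
    have ht : Tendsto (fun x => (x, r y x)) (𝓝 x₀) (𝓝 (x₀, y)) := by
      have := (continuousAt_id (x := x₀)).prodMk hc
      rwa [ContinuousAt, (hr y hy).1] at this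
    filter_upwards [ht.eventually (hr y hy).2.2] with x hx
    exact hx.mpr rfl
  have hinj : ∀ᶠ x in 𝓝 x₀, ∀ y ∈ realRoots x₀ F, ∀ y' ∈ realRoots x₀ F, y ≠ y' →
      r y x ≠ r y' x := by
    rw [Filter.eventually_all_finset]
    intro y hy
    rw [Filter.eventually_all_finset]
    intro y' hy'
    by_cases hyy : y = y'
    · exact Eventually.of_forall fun _ h => absurd hyy h
    · have h1 := (hr y hy).2.1.continuousAt
      have h2 := (hr y' hy').2.1.continuousAt
      filter_upwards [(h1.sub h2).eventually_ne
        (sub_ne_zero.mpr (by rwa [(hr y hy).1, (hr y' hy').1]))] with x hx _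
      exact sub_ne_zero.mp hx
  filter_upwards [hM, hK, hroot, hinj,
    (Polynomial.continuous_aeval F.leadingCoeff).continuousAt.eventually_ne h]
    with x hxM hxK hxr hxi hlc
  refine ⟨?_, fun y hy y' hy' hyy => by_contra fun hne => hxi y hy y' hy' hne hyy⟩
  ext y
  rw [mem_realRoots hlc, Finset.mem_image]
  refine ⟨fun hy => hxK y (abs_le.mp (hxM y hy)) hy, ?_⟩
  rintro ⟨y', hy', rfl⟩
  exact hxr y' hy'

/-! ### The crossing index. -/

/-- The signed count of the real zeros `y` of `F(x, ·)`, weighted by the side on which `φ` passes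
them and by the direction in which it may cross them. -/
noncomputable def crossingIndex (Φ F : ℤ[X][Y]) (φ : ℝ → ℝ) (x : ℝ) : ℤ :=
  ∑ y ∈ realRoots x F, (SignType.sign
    ((φ x - y) * (aevalAeval x y (totalDeriv Φ F) * aevalAeval x y (derivative F))) : ℤ)

theorem abs_sum_sign_le {ι : Type*} (s : Finset ι) (f : ι → ℝ) :
    |∑ i ∈ s, (SignType.sign (f i) : ℤ)| ≤ s.card := by
  refine (Finset.abs_sum_le_sum_abs _ _).trans ?_
  rw [Finset.card_eq_sum_ones, Nat.cast_sum]
  refine Finset.sum_le_sum fun i _ => ?_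
  rcases SignType.sign (f i) with _ | _ | _ <;> decide

/-- The root y = φ(x) contributes sign 0, leaving at most deg_Y F - 1 terms. -/
theorem abs_crossingIndex_add_one_le (Φ F : ℤ[X][Y]) (φ : ℝ → ℝ) {x : ℝ}
    (h : aeval x F.leadingCoeff ≠ 0) (hx : aevalAeval x (φ x) F = 0) :
    |crossingIndex Φ F φ x| + 1 ≤ F.natDegree := by
  have hmem := (mem_realRoots h).mpr hx
  rw [crossingIndex, ← Finset.add_sum_erase _ _ hmem, sub_self, zero_mul, sign_zero,
    SignType.coe_zero, zero_add]
  have h1 := abs_sum_sign_le ((realRoots x F).erase (φ x)) fun y =>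
    (φ x - y) * (aevalAeval x y (totalDeriv Φ F) * aevalAeval x y (derivative F))
  have h2 := Finset.card_erase_add_one hmem
  have h3 := card_realRoots_le x F
  omega

open Filter Topology in
-- On a branch r one has r' = -F_X/F_Y, so DF · F_Y = F_Y² (Φ - r') records the direction of
-- crossing. Weighting φ - r by it makes the term of a branch met at x₀ pass from -1 through 0 to 1;
-- every other term is the sign of a nonzero continuous function, hence locally constant.
theorem eventually_crossingIndex_eq (Φ F : ℤ[X][Y]) {φ : ℝ → ℝ} {x₀ : ℝ}
    (hφ : HasDerivAt φ (aevalAeval x₀ (φ x₀) Φ) x₀) (h : aeval x₀ F.leadingCoeff ≠ 0)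
    (hs : ∀ y, aevalAeval x₀ y F = 0 → aevalAeval x₀ y (derivative F) ≠ 0)
    (ht : ∀ y, aevalAeval x₀ y F = 0 → aevalAeval x₀ y (totalDeriv Φ F) ≠ 0) :
    ∀ᶠ x in 𝓝 x₀, crossingIndex Φ F φ x = crossingIndex Φ F φ x₀ +
      if aevalAeval x₀ (φ x₀) F = 0 then (SignType.sign (x - x₀) : ℤ) else 0 := by
  obtain ⟨r, hr, hev⟩ := exists_local_roots F h hs
  set q : ℝ → ℝ → ℝ := fun y x =>
    aevalAeval x (r y x) (totalDeriv Φ F) * aevalAeval x (r y x) (derivative F)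
  have hq : ∀ y ∈ realRoots x₀ F, ∃ q', HasDerivAt (q y) q' x₀ := fun y hy =>
    ⟨_, (hasDerivAt_aevalAeval_comp _ (hr y hy).2).mul (hasDerivAt_aevalAeval_comp _ (hr y hy).2)⟩
  have hterm : ∀ y ∈ realRoots x₀ F, ∀ᶠ x in 𝓝 x₀,
      SignType.sign ((φ x - r y x) * q y x) =
        if y = φ x₀ then SignType.sign (x - x₀) else SignType.sign ((φ x₀ - r y x₀) * q y x₀) := by
    intro y hy
    obtain ⟨q', hq'⟩ := hq y hy
    have hd := (hφ.sub (hr y hy).2).mul hq'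
    have hry := (hr y hy).1
    have hy0 := (mem_realRoots h).mp hy
    have hq0 : q y x₀ ≠ 0 := by
      simp only [q, hry]
      exact mul_ne_zero (ht y hy0) (hs y hy0)
    split_ifs with hyφ
    · refine eventually_nhdsWithin_sign_eq_of_deriv_pos
        (f := fun x => (φ x - r y x) * q y x) ?_
        (show (φ x₀ - r y x₀) * q y x₀ = 0 by rw [hry, ← hyφ, sub_self, zero_mul])
      have hd' : HasDerivAt (fun x => (φ x - r y x) * q y x) _ x₀ := hd
      rw [hd'.deriv]
      simp only [Pi.sub_apply, hry, ← hyφ, sub_self, zero_mul, add_zero, q]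
      have h1 := hs y hy0
      have h2 := ht y hy0
      have h3 : aevalAeval x₀ y (totalDeriv Φ F) = aevalAeval x₀ y (derivX F) +
        aevalAeval x₀ y Φ * aevalAeval x₀ y (derivative F) := by
        simp only [totalDeriv, map_add, map_mul]
      -- Since Φ - r' = DF/F_Y, the derivative at the meeting point is (DF)², positive whatever the
      -- direction.
      have h4 : (aevalAeval x₀ y Φ - -aevalAeval x₀ y (derivX F) / aevalAeval x₀ y (derivative F)) *
          (aevalAeval x₀ y (totalDeriv Φ F) * aevalAeval x₀ y (derivative F)) =
          aevalAeval x₀ y (totalDeriv Φ F) ^ 2 := by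
        rw [h3]
        field_simp
        ring
      rw [h4]
      positivity
    · have hne : (φ x₀ - r y x₀) * q y x₀ ≠ 0 :=
        mul_ne_zero (sub_ne_zero.mpr (by rw [hry]; exact Ne.symm hyφ)) hq0
      have hc : ContinuousAt (fun x => (φ x - r y x) * q y x) x₀ := hd.continuousAt
      rcases hne.lt_or_gt with hlt | hgt
      · filter_upwards [hc.eventually (gt_mem_nhds hlt)] with x hx
        rw [sign_neg hx, sign_neg hlt]
      · filter_upwards [hc.eventually (lt_mem_nhds hgt)] with x hx
        rw [sign_pos hx, sign_pos hgt]
  filter_upwards [hev, (Filter.eventually_all_finset _).mpr hterm] with x hx hxt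
  have h0 : crossingIndex Φ F φ x₀ =
      ∑ y ∈ realRoots x₀ F, (SignType.sign ((φ x₀ - r y x₀) * q y x₀) : ℤ) :=
    Finset.sum_congr rfl fun y hy => by simp only [q, (hr y hy).1]
  have h1 : crossingIndex Φ F φ x =
      ∑ y ∈ realRoots x₀ F, (SignType.sign ((φ x - r y x) * q y x) : ℤ) := by
    rw [crossingIndex, hx.1, Finset.sum_image hx.2]
  have h2 : (if aevalAeval x₀ (φ x₀) F = 0 then (SignType.sign (x - x₀) : ℤ) else 0) =
      ∑ y ∈ realRoots x₀ F, if y = φ x₀ then (SignType.sign (x - x₀) : ℤ) else 0 := by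
    rw [Finset.sum_ite_eq']
    simp only [mem_realRoots h]
  rw [h0, h1, h2, ← Finset.sum_add_distrib]
  refine Finset.sum_congr rfl fun y hy => ?_
  rw [hxt y hy]
  split_ifs with hyφ
  · rw [(hr y hy).1, hyφ]
    simp
  · simp

/-- On an interval over which the real zeros of `F(x, ·)` are simple, of constant degree and transverse
to the vector field, a solution meets the curve `F = 0` at most `deg_Y F` times. -/
theorem card_zeros_le_natDegree (Φ F : ℤ[X][Y]) {φ : ℝ → ℝ} {J : Set ℝ} (hJ : J.OrdConnected)
    (hφ : ∀ x ∈ J, HasDerivAt φ (aevalAeval x (φ x) Φ) x)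
    (h : ∀ x ∈ J, aeval x F.leadingCoeff ≠ 0)
    (hs : ∀ x ∈ J, ∀ y, aevalAeval x y F = 0 → aevalAeval x y (derivative F) ≠ 0)
    (ht : ∀ x ∈ J, ∀ y, aevalAeval x y F = 0 → aevalAeval x y (totalDeriv Φ F) ≠ 0)
    (T : Finset ℝ) (hT : ∀ x ∈ T, x ∈ J ∧ aevalAeval x (φ x) F = 0) :
    T.card ≤ F.natDegree := by
  classical
  refine card_le_of_jumps (W := crossingIndex Φ F φ) (Z := {x ∈ J | aevalAeval x (φ x) F = 0}) hJ
    (fun x hx => ?_) (fun x hx => abs_crossingIndex_add_one_le Φ F φ (h x hx.1) hx.2) T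
    (fun x hx => ⟨(hT x hx).1, hT x hx⟩)
  simpa [hx] using eventually_crossingIndex_eq Φ F (hφ x hx) (h x hx) (hs x hx) (ht x hx)

/-! ### Global count of zeros. -/

theorem encard_le_of_forall_finset {α : Type*} {s : Set α} {n : ℕ}
    (h : ∀ T : Finset α, (∀ x ∈ T, x ∈ s) → T.card ≤ n) : s.encard ≤ n := by
  by_contra! hlt
  obtain ⟨t, hts, ht⟩ := Set.exists_subset_encard_eq (Order.add_one_le_of_lt hlt)
  have hfin : t.Finite := Set.finite_of_encard_eq_coe (k := n + 1) (by exact_mod_cast ht)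
  have := h hfin.toFinset fun x hx => hts (hfin.mem_toFinset.mp hx)
  rw [hfin.encard_eq_coe_toFinset_card] at ht
  have h2 : hfin.toFinset.card = n + 1 := by exact_mod_cast ht
  omega

/-- Removing S leaves at most |S| + 1 order-convex pieces, indexed by the number of points of S to
the left. Each piece holds at most d points of Z, and S itself at most |S|. -/
theorem encard_le_of_interval_bound {I Z : Set ℝ} (hI : I.OrdConnected) (hZ : Z ⊆ I)
    (S : Finset ℝ) {d : ℕ}
    (h : ∀ J ⊆ I, J.OrdConnected → (∀ x ∈ J, x ∉ S) →
      ∀ T : Finset ℝ, (∀ x ∈ T, x ∈ J ∧ x ∈ Z) → T.card ≤ d) :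
    Z.encard ≤ ((d + 1) * S.card + d : ℕ) := by
  classical
  refine encard_le_of_forall_finset fun T hT => ?_
  let c : ℝ → ℕ := fun x => (S.filter (· < x)).card
  have hc : Monotone c := fun x y hxy =>
    Finset.card_le_card (Finset.monotone_filter_right S fun s _ hs => lt_of_lt_of_le hs hxy)
  have hfib : ∀ k ∈ Finset.range (S.card + 1), ((T \ S).filter (c · = k)).card ≤ d := by
    intro k _
    refine h {x ∈ I | x ∉ S ∧ c x = k} (fun x hx => hx.1) ⟨fun a ha b hb x hx => ?_⟩
      (fun x hx => hx.2.1) _ fun x hx => ?_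
    · have hk : c x = k := le_antisymm ((hc hx.2).trans_eq hb.2.2) (ha.2.2.symm.trans_le (hc hx.1))
      refine ⟨hI.out ha.1 hb.1 hx, fun hxS => ?_, hk⟩
      have hxb : x < b := lt_of_le_of_ne hx.2 fun h => hb.2.1 (h ▸ hxS)
      have hlt : c x < c b := Finset.card_lt_card <| by
        refine Finset.ssubset_iff_of_subset
          (Finset.monotone_filter_right S fun s _ hs => lt_trans hs hxb) |>.mpr ⟨x, ?_, ?_⟩
        · simp [hxS, hxb]
        · simp
      exact absurd hlt (by rw [hk, hb.2.2]; exact lt_irrefl k)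
    · simp only [Finset.mem_filter, Finset.mem_sdiff] at hx
      exact ⟨⟨hZ (hT x hx.1.1), hx.1.2, hx.2⟩, hT x hx.1.1⟩
  have h1 := Finset.card_le_mul_card_image_of_maps_to (s := T \ S) (f := c)
    (t := Finset.range (S.card + 1)) (fun x _ => Finset.mem_range.mpr
      (Nat.lt_succ_of_le (Finset.card_filter_le _ _))) d hfib
  have h2 := Finset.card_sdiff_add_card_inter T S
  have h3 := Finset.card_le_card (Finset.inter_subset_right (s₁ := T) (s₂ := S))
  rw [Finset.card_range] at h1
  nlinarith

/-- The real zeros of an integer polynomial. -/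
theorem exists_finset_real_zeros {p : ℤ[X]} (hp : p ≠ 0) :
    ∃ S : Finset ℝ, S.card ≤ p.natDegree ∧ ∀ x : ℝ, x ∈ S ↔ aeval x p = 0 := by
  refine ⟨(p.aroots ℝ).toFinset, (Multiset.toFinset_card_le _).trans
    ((card_roots' _).trans natDegree_map_le), fun x => ?_⟩
  rw [Multiset.mem_toFinset, mem_aroots, and_iff_right hp]

theorem encard_zeros_le_of_not_dvd {Φ F : ℤ[X][Y]} (hΦ : 0 < Φ.natDegree) (hF : Prime F)
    (hd : 0 < F.natDegree) (hndvd : ¬ F ∣ totalDeriv Φ F) {φ : ℝ → ℝ} {U I : Set ℝ}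
    (hφ : SolvesOn Φ φ U) (hI : I.OrdConnected) (hIU : I ⊆ U) :
    {x ∈ I | aevalAeval x (φ x) F = 0}.encard ≤
      ((F.natDegree + 1) * ((2 * F.natDegree ^ 2 + Φ.natDegree) * degX F +
        F.natDegree * degX Φ) + F.natDegree : ℕ) := by
  have hder : ¬ F ∣ derivative F := fun h => by
    have h0 := eq_zero_of_dvd_of_natDegree_lt h (natDegree_derivative_lt hd.ne')
    exact hd.ne' (derivative_eq_zero.mp h0)
  obtain ⟨S, hS, hSmem⟩ := exists_finset_real_zeros
    (mul_ne_zero (resultant_ne_zero_of_prime hF hder) (resultant_ne_zero_of_prime hF hndvd))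
  have key := encard_le_of_interval_bound (Z := {x ∈ I | aevalAeval x (φ x) F = 0}) hI
    (fun x hx => hx.1) S (d := F.natDegree) fun J hJI hJ hJS T hT => by
      have hne : ∀ x ∈ J, aeval x (resultant F (derivative F)) ≠ 0 ∧
          aeval x (resultant F (totalDeriv Φ F)) ≠ 0 := fun x hx => by
        have := mt (hSmem x).mpr (hJS x hx)
        rwa [map_mul, mul_eq_zero, not_or] at this
      exact card_zeros_le_natDegree Φ F hJ (fun x hx => hφ.2 x (hIU (hJI hx)))
        (fun x hx h0 => (hne x hx).1 (aeval_resultant_derivative_eq_zero hd h0))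
        (fun x hx y h1 h2 => (hne x hx).1 (aeval_resultant_eq_zero hd h1 h2))
        (fun x hx y h1 h2 => (hne x hx).2 (aeval_resultant_eq_zero hd h1 h2))
        T fun x hx => ⟨(hT x hx).1, (hT x hx).2.2⟩
  refine key.trans (Nat.cast_le.mpr ?_)
  gcongr
  refine hS.trans (natDegree_mul_le.trans ?_)
  have h1 := natDegree_resultant_le F (derivative F)
  have h2 := natDegree_resultant_le F (totalDeriv Φ F)
  have h3 := degX_derivative_le F
  have h4 := degX_totalDeriv_le Φ F
  have h5 := natDegree_totalDeriv_le Φ F hΦ hd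
  have h6 := natDegree_derivative_le F
  obtain ⟨k, hk⟩ := Nat.exists_eq_add_of_lt hd
  rw [zero_add] at hk
  rw [hk, Nat.add_sub_cancel] at h5 h6
  rw [hk] at h1 h2 ⊢
  calc _ ≤ (k * degX F + (k + 1) * degX F) +
        ((k + Φ.natDegree) * degX F + (k + 1) * (degX F + degX Φ)) := by
        refine add_le_add (h1.trans ?_) (h2.trans ?_) <;> gcongr
    -- With d = k + 1, the coefficient 4d - 2 of `degX F` is replaced by 2d²; the difference is 2k².
    _ ≤ _ := by nlinarith [Nat.zero_le (degX F * k ^ 2)]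

theorem forall_aevalAeval_eq_zero_of_dvd {Φ F : ℤ[X][Y]} (h : F ∣ totalDeriv Φ F) {φ : ℝ → ℝ}
    {U I : Set ℝ} (hφ : SolvesOn Φ φ U) (hI : I.OrdConnected) (hIU : I ⊆ U) {a b : ℝ}
    (ha : a ∈ I) (hb : b ∈ I) (h0 : aevalAeval a (φ a) F = 0) : aevalAeval b (φ b) F = 0 := by
  obtain ⟨H, hH⟩ := h
  refine eq_zero_of_linear_ode (g := fun x => aevalAeval x (φ x) F)
    (h := fun x => aevalAeval x (φ x) H) hI (fun x hx => ?_)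
    ((hφ.continuousOn_aevalAeval H).mono hIU) ha hb h0
  refine (hφ.hasDerivAt_aevalAeval F (hIU hx)).congr_deriv ?_
  rw [hH, map_mul, mul_comm]

theorem encard_zeros_le_of_prime {Φ F : ℤ[X][Y]} (hΦ : 0 < Φ.natDegree) (hF : Prime F)
    {φ : ℝ → ℝ} {U I : Set ℝ} (hφ : SolvesOn Φ φ U) (hI : I.OrdConnected) (hIU : I ⊆ U)
    (hne : ∃ x ∈ I, aevalAeval x (φ x) F ≠ 0) :
    {x ∈ I | aevalAeval x (φ x) F = 0}.encard ≤
      ((F.natDegree + 1) * ((2 * F.natDegree ^ 2 + Φ.natDegree) * degX F +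
        F.natDegree * degX Φ) + F.natDegree : ℕ) := by
  rcases Nat.eq_zero_or_pos F.natDegree with hd | hd
  · obtain ⟨p, rfl⟩ := natDegree_eq_zero.mp hd
    have hp : p ≠ 0 := fun h => hF.ne_zero (by rw [h, C_0])
    obtain ⟨S, hS, hmem⟩ := exists_finset_real_zeros hp
    have hsub : {x ∈ I | aevalAeval x (φ x) (C p) = 0} ⊆ S := fun x hx => by
      rw [Finset.mem_coe, hmem, ← aevalAeval_C x (φ x)]
      exact hx.2
    refine (Set.encard_le_encard hsub).trans ?_
    rw [Set.encard_coe_eq_coe_finsetCard, Nat.cast_le]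
    have h1 := natDegree_coeff_le_degX (C p) 0
    rw [coeff_C_zero] at h1
    -- The bound is now deg_Y Φ · deg_X F, which suffices because deg_Y Φ ≥ 1.
    rw [hd]
    nlinarith
  by_cases hdvd : F ∣ totalDeriv Φ F
  · obtain ⟨b, hb, hb0⟩ := hne
    have : {x ∈ I | aevalAeval x (φ x) F = 0} = ∅ := Set.eq_empty_of_forall_notMem fun x hx =>
      hb0 (forall_aevalAeval_eq_zero_of_dvd hdvd hφ hI hIU hx.1 hb hx.2)
    rw [this, Set.encard_empty]
    exact zero_le
  · exact encard_zeros_le_of_not_dvd hΦ hF hd hdvd hφ hI hIU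

theorem encard_zeros_le {Φ F : ℤ[X][Y]} (hΦ : 0 < Φ.natDegree) {φ : ℝ → ℝ} {U I : Set ℝ}
    (hφ : SolvesOn Φ φ U) (hI : I.OrdConnected) (hIU : I ⊆ U)
    (hne : ∃ x ∈ I, aevalAeval x (φ x) F ≠ 0) :
    {x ∈ I | aevalAeval x (φ x) F = 0}.encard ≤
      ((F.natDegree + 1) * ((2 * F.natDegree ^ 2 + Φ.natDegree) * degX F +
        F.natDegree * degX Φ) + F.natDegree : ℕ) := by
  induction F using UniqueFactorizationMonoid.induction_on_prime with
  | h₁ => simp at hne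
  | h₂ F hF =>
    have : {x ∈ I | aevalAeval x (φ x) F = 0} = ∅ := Set.eq_empty_of_forall_notMem fun x hx =>
      (hF.map (aevalAeval x (φ x))).ne_zero hx.2
    rw [this, Set.encard_empty]
    exact zero_le
  | h₃ F p hF hp ih =>
    obtain ⟨a, ha, ha0⟩ := hne
    rw [map_mul] at ha0
    have h1 := encard_zeros_le_of_prime hΦ hp hφ hI hIU ⟨a, ha, left_ne_zero_of_mul ha0⟩
    have h2 := ih ⟨a, ha, right_ne_zero_of_mul ha0⟩
    have hsub : {x ∈ I | aevalAeval x (φ x) (p * F) = 0} ⊆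
        {x ∈ I | aevalAeval x (φ x) p = 0} ∪ {x ∈ I | aevalAeval x (φ x) F = 0} := by
      rintro x ⟨hx, h0⟩
      rw [map_mul, mul_eq_zero] at h0
      exact h0.imp (fun h => ⟨hx, h⟩) (fun h => ⟨hx, h⟩)
    refine (Set.encard_le_encard hsub).trans ((Set.encard_union_le _ _).trans
      ((add_le_add h1 h2).trans ?_))
    rw [natDegree_mul hp.ne_zero hF, degX_mul hp.ne_zero hF, ← Nat.cast_add, Nat.cast_le]
    generalize p.natDegree = d₁
    generalize F.natDegree = d₂
    generalize degX p = e₁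
    generalize degX F = e₂
    generalize Φ.natDegree = m
    generalize degX Φ = n
    -- Superadditivity: enlarging d₁ and d₂ to d₁ + d₂ in the outer factor and in the square makes
    -- the two bounds add up exactly.
    calc _ ≤ (d₁ + d₂ + 1) * ((2 * (d₁ + d₂) ^ 2 + m) * e₁ + d₁ * n) + d₁ +
          ((d₁ + d₂ + 1) * ((2 * (d₁ + d₂) ^ 2 + m) * e₂ + d₂ * n) + d₂) := by
          gcongr <;> omega
      _ = _ := by ring

/-! ### The exceptional linear case and the final comparison. -/

/-- If `F = a Y + b` with integers `a` and `b`, then Rolle's theorem bounds the number of zeros. -/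
theorem encard_zeros_le_of_linear {Φ F : ℤ[X][Y]} {φ : ℝ → ℝ} {U I : Set ℝ}
    (hφ : SolvesOn Φ φ U) (hI : I.OrdConnected) (hIU : I ⊆ U) (hY : F.natDegree = 1)
    (hX : degX F = 0) (hne : ∃ x ∈ I, aevalAeval x (φ x) F ≠ 0) :
    {x ∈ I | aevalAeval x (φ x) F = 0}.encard ≤ (degX Φ + 1 : ℕ) := by
  obtain ⟨a, ha⟩ := natDegree_eq_zero.mp (degX_le_iff.mp hX.le 1 |> Nat.le_zero.mp)
  obtain ⟨b, hb⟩ := natDegree_eq_zero.mp (degX_le_iff.mp hX.le 0 |> Nat.le_zero.mp)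
  have ha0 : (a : ℝ) ≠ 0 := fun h => by
    have h1 : F.leadingCoeff = 0 := by
      rw [leadingCoeff, hY, ← ha, Int.cast_eq_zero.mp h, C_0]
    rw [leadingCoeff_eq_zero.mp h1, natDegree_zero] at hY
    exact one_ne_zero hY.symm
  set c : ℝ := -b / a
  have hF : ∀ x y : ℝ, aevalAeval x y F = 0 ↔ y - c = 0 := fun x y => by
    rw [eq_X_add_C_of_natDegree_le_one hY.le, ← ha, ← hb, map_add, map_mul, aevalAeval_C,
      aevalAeval_C, aevalAeval_Y]
    simp only [c, aeval_C, algebraMap_int_eq, Int.coe_castRingHom]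
    rw [sub_eq_zero, eq_div_iff ha0, eq_neg_iff_add_eq_zero, mul_comm]
  simp only [hF]
  set P : ℝ[X] := ∑ i ∈ Finset.range (Φ.natDegree + 1),
    (Φ.coeff i).map (algebraMap ℤ ℝ) * C (c ^ i)
  have hΦsum : ∀ x y : ℝ, aevalAeval x y Φ =
      ∑ i ∈ Finset.range (Φ.natDegree + 1), aeval x (Φ.coeff i) * y ^ i := fun x y => by
    rw [← eval_fiber, eval_eq_sum_range' (p := fiber x Φ) (Nat.lt_succ_of_le natDegree_map_le)]
    simp only [coeff_fiber]
  have hP : ∀ x, P.eval x = aevalAeval x c Φ := fun x => by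
    rw [hΦsum, eval_finsetSum]
    simp only [eval_mul, eval_C, eval_map_algebraMap]
  have hPdeg : P.natDegree ≤ degX Φ := natDegree_sum_le_of_forall_le _ _ fun i _ =>
    (natDegree_mul_C_le _ _).trans (natDegree_map_le.trans (natDegree_coeff_le_degX Φ i))
  -- The difference quotient of Φ(x, ·) between φ(x) and c, as a polynomial expression. Thus g = φ -
  -- c solves g' = qg + P with P(x) = Φ(x, c), and P has a zero between any two zeros of g.
  set q : ℝ → ℝ := fun x => ∑ i ∈ Finset.range (Φ.natDegree + 1), aeval x (Φ.coeff i) *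
    ∑ j ∈ Finset.range i, φ x ^ j * c ^ (i - 1 - j)
  have hq : ∀ x, aevalAeval x (φ x) Φ = q x * (φ x - c) + P.eval x := fun x => by
    rw [hP, hΦsum, hΦsum, Finset.sum_mul, ← Finset.sum_add_distrib]
    refine Finset.sum_congr rfl fun i _ => ?_
    rw [mul_assoc, geom_sum₂_mul]
    ring
  have hd : ∀ x ∈ I, HasDerivAt (fun x => φ x - c) (q x * (φ x - c) + P.eval x) x :=
    fun x hx => (((hφ.2 x (hIU hx)).sub_const c).congr_deriv (hq x))
  have hφc : ContinuousOn φ I := fun x hx => (hφ.2 x (hIU hx)).continuousAt.continuousWithinAt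
  have hqc : ContinuousOn q I := continuousOn_finsetSum _ fun i _ =>
    (Polynomial.continuous_aeval _).continuousOn.mul
      (continuousOn_finsetSum _ fun j _ => (hφc.pow j).mul continuousOn_const)
  have hP0 : P ≠ 0 ∨ {x ∈ I | φ x - c = 0} = ∅ := by
    refine or_iff_not_imp_left.mpr fun h => Set.eq_empty_of_forall_notMem fun x hx => ?_
    obtain ⟨y, hy, hy0⟩ := hne
    exact hy0 ((hF y (φ y)).mpr <| eq_zero_of_linear_ode (g := fun x => φ x - c) hI
      (fun x hx => (hd x hx).congr_deriv (by rw [not_not.mp h]; simp)) hqc hx.1 hy hx.2)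
  rcases hP0 with hP0 | hempty
  · refine encard_le_of_forall_finset fun T hT => ?_
    refine (Finset.card_le_of_interleaved (t := P.roots.toFinset) fun x hx y hy hxy _ => ?_).trans
      (Nat.succ_le_succ ((Multiset.toFinset_card_le _).trans ((card_roots' _).trans hPdeg)))
    have hsub := hI.out (hT x hx).1 (hT y hy).1
    obtain ⟨z, hz, hz0⟩ := exists_eq_zero_of_linear_ode hxy (fun z hz => hd z (hsub hz))
      (hqc.mono hsub) (hT x hx).2 (hT y hy).2
    exact ⟨z, by simpa [hP0] using hz0, hz⟩
  · rw [hempty, Set.encard_empty]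
    exact zero_le

theorem mainTheorem6 (F Φ : ℤ[X][Y]) (hF : 0 < degY F) (hΦ : 0 < degY Φ)
    (hX : 0 < degX F + degX Φ)
    (φ : ℝ → ℝ) (U : Set ℝ) (hφ : SolvesOn Φ φ U)
    (f : ℝ → ℝ) (hf : ∀ x ∈ U, f x = aevalAeval x (φ x) F)
    (I : Set ℝ) (hIopen : IsOpen I) (hIint : I.OrdConnected) (hIU : I ⊆ U)
    (hne : ∃ x ∈ I, f x ≠ 0) :
    {x ∈ I | f x = 0}.encard ≤
      (((degY F + 1) * (2 * degY F ^ 2 - degY F) *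
        ((degY Φ + 3) * degX F + degX Φ) : ℕ) : ℕ∞) := by
  obtain ⟨a, ha, ha0⟩ := hne
  rw [hf a (hIU ha)] at ha0
  have hset : {x ∈ I | f x = 0} = {x ∈ I | aevalAeval x (φ x) F = 0} :=
    Set.ext fun x => and_congr_right fun hx => by rw [hf x (hIU hx)]
  rw [hset]
  unfold degY at *
  by_cases hlin : F.natDegree = 1 ∧ degX F = 0
  · refine (encard_zeros_le_of_linear hφ hIint hIU hlin.1 hlin.2 ⟨a, ha, ha0⟩).trans
      (Nat.cast_le.mpr ?_)
    rw [hlin.1, hlin.2]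
    omega
  refine (encard_zeros_le hΦ hφ hIint hIU ⟨a, ha, ha0⟩).trans (Nat.cast_le.mpr ?_)
  generalize F.natDegree = d at *
  generalize degX F = e at *
  generalize Φ.natDegree = m at *
  generalize degX Φ = n at *
  obtain ⟨k, rfl⟩ := Nat.exists_eq_add_of_lt hF
  have h1 : 2 * (0 + k + 1) ^ 2 - (0 + k + 1) = (k + 1) * (2 * k + 1) := by
    rw [Nat.sub_eq_iff_eq_add (by nlinarith)]
    ring
  rw [h1]
  rcases Nat.eq_zero_or_pos e with rfl | he
  -- For d_X = 0 the excluded linear case forces d_Y = k + 1 ≥ 2, and then δ_X > 0; the surplus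
  -- (k+1)(k+2)(2k)n absorbs the additive term d_Y.
  · have hk : 0 < k := by omega
    have hn : 0 < n := by omega
    have h2 : k + 1 ≤ (k + 1) * ((k + 2) * (2 * k) * n) :=
      Nat.le_mul_of_pos_right _ (by positivity)
    linarith
  · have h2 : k + 1 ≤ (k + 1) * ((k + 2) * e) := Nat.le_mul_of_pos_right _ (by positivity)
    have h3 : 0 ≤ (k + 2) * e * (m * (2 * k ^ 2 + 3 * k) + 4 * k ^ 2 + 4 * k) +
      (k + 2) * (k + 1) * (2 * k) * n := Nat.zero_le _
    linarith
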